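/- Let $G=(V,E)$ be a finite simple graph. An orthonormal representation of $G$ is a family of unit vectors $\{\mathbf{x}_v\in\mathbb{R}^n : v\in V\}$, for some positive integer $n$, with $\langle \mathbf{x}_u,\mathbf{x}_v\rangle=0$ whenever $u\ne v$ and $uv\notin E$. The Lovász theta function of $G$ is $$\theta(G)=\inf\ \max_{v\in V}\frac{1}{\langle \mathbf{x}_v,\mathbf{h}\rangle^2},$$ where the infimum is over all $n$, all orthonormal representations $\{\mathbf{x}_v\}$ of $G$ in $\mathbb{R}^n$ and all unit vectors $\mathbf{h}\in\mathbb{R}^n$. A matrix representation of $G$ is a family of matrices $\{M_v\in\mathbb{R}^{n\times d_v}: v\in V\}$, with positive integers $n$ and $d_v$, such that $M_v^TM_v=I_{d_v}$ for every $v\in V$ and $M_u^TM_v=0$ whenever $u\neq v$ and $uv\notin E$. For a positive integer $k$, a $k$-handle is a matrix $H\in\mathbb{R}^{n\times k}$ each of whose columns has Euclidean norm $1$. Define $$\theta_f(G)=\inf_{k\ge 1}\ \inf_{\{M_v\}}\ \inf_{H}\ \max_{v\in V}\frac{k}{\operatorname{tr}(M_v^THH^TM_v)},$$ where $\{M_v\in\mathbb{R}^{n\times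 d_v}\}$ runs over all matrix representations of $G$ (with arbitrary $n$ and $d_v$) and $H\in\mathbb{R}^{n\times k}$ over all $k$-handles with the same $n$. Quotients with denominator $0$ are $+\infty$, and the maximum over an empty vertex set is $0$. Then $\theta(G)$ is finite and $\theta_f(G)=\theta(G)$. Moreover, if $\{M_v\in\mathbb{R}^{n\times d_v}:v\in V\}$ is a matrix representation of $G$, $\{\bar M_v\in\mathbb{R}^{\bar n\times\bar d_v}:v\in V\}$ is a matrix representation of the complement $\overline{G}$, $H\in\mathbb{R}^{n\times k}$ is a $k$-handle and $\bar H\in\mathbb{R}^{\bar n\times\bar k}$ is a $\bar k$-handle, with $k,\bar k\ge 1$, then $$k\,\bar k\ \ge\ \sum_{v\in V}\operatorname{tr}(M_v^THH^TM_v)\,\operatorname{tr}(\bar M_v^T\bar H\bar H^T\bar M_v).$$ -/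

import Mathlib

open scoped ENNReal Matrix

namespace LovaszTheta

variable {V : Type*}

/-- An orthonormal representation of `G` in `ℝⁿ`: unit vectors indexed by the vertices, those of
distinct non-adjacent vertices being orthogonal. -/
structure IsOrthonormalRepresentation (G : SimpleGraph V) {n : ℕ}
    (x : V → EuclideanSpace ℝ (Fin n)) : Prop where
  norm_eq_one : ∀ v, ‖x v‖ = 1
  inner_eq_zero : ∀ u v, u ≠ v → ¬ G.Adj u v → inner ℝ (x u) (x v) = 0

/-- A handle is a unit vector. -/
def IsHandle {n : ℕ} (h : EuclideanSpace ℝ (Fin n)) : Prop :=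
  ‖h‖ = 1

/-- The Lovász theta function: the infimum, over all orthonormal representations of `G` (in all
dimensions) and all handles, of `max_v 1 / ⟨x_v, h⟩²`. Values are taken in `[0, ∞]`, where
`1 / 0 = ∞`. -/
noncomputable def theta (G : SimpleGraph V) : ℝ≥0∞ :=
  ⨅ (n : ℕ) (x : V → EuclideanSpace ℝ (Fin n)) (h : EuclideanSpace ℝ (Fin n))
    (_ : IsOrthonormalRepresentation G x) (_ : IsHandle h),
    ⨆ v : V, 1 / ENNReal.ofReal (inner ℝ (x v) h ^ 2)

/-- A matrix representation of `G`: matrices `M_v ∈ ℝ^{n × d_v}` with `d_v ≥ 1`,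
`M_vᵀ M_v = I`, and `M_uᵀ M_v = 0` for distinct non-adjacent `u`, `v`. -/
structure IsMatrixRepresentation (G : SimpleGraph V) {n : ℕ} {d : V → ℕ}
    (M : ∀ v, Matrix (Fin n) (Fin (d v)) ℝ) : Prop where
  d_pos : ∀ v, 0 < d v
  transpose_mul_self : ∀ v, (M v)ᵀ * M v = 1
  transpose_mul_eq_zero : ∀ u v, u ≠ v → ¬ G.Adj u v → (M u)ᵀ * M v = 0

/-- A `k`-handle is an `n × k` real matrix all of whose columns have Euclidean norm `1`. -/
def IsKHandle {n k : ℕ} (H : Matrix (Fin n) (Fin k) ℝ) : Prop :=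
  ∀ i : Fin k, ‖WithLp.toLp 2 (fun a : Fin n => H a i)‖ = 1

/-- The matrix fractionalization of the theta function: the infimum, over all `k ≥ 1`, all matrix
representations of `G` (with any `n` and any sizes `d_v`) and all `k`-handles `H` with the same
`n`, of `max_v k / tr(M_vᵀ H Hᵀ M_v)`. The traces are nonnegative, and values are taken in
`[0, ∞]`, where `k / 0 = ∞`. -/
noncomputable def thetaF (G : SimpleGraph V) : ℝ≥0∞ :=
  ⨅ (k : ℕ) (_ : 0 < k) (n : ℕ) (d : V → ℕ) (M : ∀ v, Matrix (Fin n) (Fin (d v)) ℝ)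
    (_ : IsMatrixRepresentation G M) (H : Matrix (Fin n) (Fin k) ℝ) (_ : IsKHandle H),
    ⨆ v : V, (k : ℝ≥0∞) / ENNReal.ofReal ((M v)ᵀ * H * Hᵀ * M v).trace

end LovaszTheta

namespace LovaszTheta

/-! Since `M_vᵀ M_v = I`, the matrix `M_v M_vᵀ` is an orthogonal projection. Let `g` be `H`
flattened into `ℝ^{nk}` and `z_v` the flattening of `M_v M_vᵀ H`. Then `⟪z_v, g⟫ = ‖z_v‖² = t_v`,
the trace in the statement, `‖g‖² = k`, and `z_u ⊥ z_v` whenever `M_uᵀ M_v = 0`. If all `t_v > 0`,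
normalising the `z_v` and `g` gives an ordinary representation and handle with the same value
(`theta_le_thetaF`); conversely, vectors are one-column matrices. For the product inequality, the
tensors `z_v ⊗ z'_v` are pairwise orthogonal, and Bessel's inequality against `g ⊗ g'` bounds the
sum by `k k'`. -/

/-- The entries of an `n × k` matrix, as a vector of `ℝ^{nk}`. -/
noncomputable def flatten {n k : ℕ} (A : Matrix (Fin n) (Fin k) ℝ) :
    EuclideanSpace ℝ (Fin (n * k)) :=
  WithLp.toLp 2 fun i => A (finProdFinEquiv.symm i).1 (finProdFinEquiv.symm i).2

theorem inner_flatten {n k : ℕ} (A B : Matrix (Fin n) (Fin k) ℝ) :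
    inner ℝ (flatten A) (flatten B) = (Aᵀ * B).trace := by
  simp only [flatten, PiLp.inner_apply, Matrix.trace, Matrix.diag, Matrix.mul_apply,
    Matrix.transpose_apply]
  rw [Equiv.sum_comp finProdFinEquiv.symm (fun p => inner ℝ (A p.1 p.2) (B p.1 p.2)),
    Fintype.sum_prod_type, Finset.sum_comm]
  simp [mul_comm]

theorem IsKHandle.inner_flatten_self {n k : ℕ} {H : Matrix (Fin n) (Fin k) ℝ}
    (hH : IsKHandle H) : inner ℝ (flatten H) (flatten H) = (k : ℝ) := by
  rw [inner_flatten, Matrix.trace]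
  have h : ∀ i, (Hᵀ * H).diag i = 1 := fun i => by
    have := EuclideanSpace.real_norm_sq_eq (WithLp.toLp 2 fun a => H a i)
    rw [hH i] at this
    simpa [Matrix.mul_apply, ← sq] using this.symm
  simp only [h, Finset.sum_const, Finset.card_univ, Fintype.card_fin, nsmul_eq_mul, mul_one]

/-- The columns of `H` projected onto the column space of `M`, as one vector. -/
noncomputable def projectedHandle {n k d : ℕ} (M : Matrix (Fin n) (Fin d) ℝ)
    (H : Matrix (Fin n) (Fin k) ℝ) : EuclideanSpace ℝ (Fin (n * k)) :=
  flatten (M * Mᵀ * H)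

theorem inner_projectedHandle_flatten {n k d : ℕ} (M : Matrix (Fin n) (Fin d) ℝ)
    (H : Matrix (Fin n) (Fin k) ℝ) :
    inner ℝ (projectedHandle M H) (flatten H) = (Mᵀ * H * Hᵀ * M).trace := by
  rw [projectedHandle, inner_flatten, Matrix.trace_mul_comm, Matrix.mul_assoc (Mᵀ * H),
    Matrix.mul_assoc Mᵀ, Matrix.trace_mul_comm Mᵀ]
  simp [Matrix.transpose_mul, Matrix.mul_assoc]

theorem inner_projectedHandle_projectedHandle {n k d e : ℕ} (M : Matrix (Fin n) (Fin d) ℝ)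
    (N : Matrix (Fin n) (Fin e) ℝ) (H : Matrix (Fin n) (Fin k) ℝ) :
    inner ℝ (projectedHandle M H) (projectedHandle N H) =
      (Hᵀ * M * (Mᵀ * N) * Nᵀ * H).trace := by
  simp [projectedHandle, inner_flatten, Matrix.transpose_mul, Matrix.mul_assoc]

/-- `M * Mᵀ` is symmetric and idempotent, so pairing the projection of `H` with itself is pairing it
with `H`. -/
theorem inner_projectedHandle_self {n k d : ℕ} {M : Matrix (Fin n) (Fin d) ℝ}
    (hM : Mᵀ * M = 1) (H : Matrix (Fin n) (Fin k) ℝ) :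
    inner ℝ (projectedHandle M H) (projectedHandle M H) = (Mᵀ * H * Hᵀ * M).trace := by
  rw [inner_projectedHandle_projectedHandle, hM, ← inner_projectedHandle_flatten, projectedHandle,
    inner_flatten]
  simp [Matrix.transpose_mul, Matrix.mul_assoc]

theorem inner_projectedHandle_eq_zero {n k d e : ℕ} {M : Matrix (Fin n) (Fin d) ℝ}
    {N : Matrix (Fin n) (Fin e) ℝ} (h : Mᵀ * N = 0) (H : Matrix (Fin n) (Fin k) ℝ) :
    inner ℝ (projectedHandle M H) (projectedHandle N H) = 0 := by
  simp [inner_projectedHandle_projectedHandle, h]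

/-- The squared norms of orthogonal vectors `z i` with `⟪z i, g⟫ = ‖z i‖²` sum to at most `‖g‖²`. -/
theorem sum_inner_self_le {ι E : Type*} [Fintype ι] [NormedAddCommGroup E] [InnerProductSpace ℝ E]
    (z : ι → E) (g : E) (horth : Pairwise fun i j => inner ℝ (z i) (z j) = 0)
    (hg : ∀ i, inner ℝ (z i) g = inner ℝ (z i) (z i)) :
    ∑ i, inner ℝ (z i) (z i) ≤ inner ℝ g g := by
  -- In this expansion the pairing of the sum with `g` and the squared norm of the sum agree. No `z
  -- i` is normalised, so zero vectors are allowed.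
  have h0 : 0 ≤ inner ℝ (g - ∑ i, z i) (g - ∑ i, z i) := real_inner_self_nonneg
  have h1 : inner ℝ (∑ i, z i) g = ∑ i, inner ℝ (z i) (z i) := by
    simp only [sum_inner, hg]
  have h2 : inner ℝ (∑ i, z i) (∑ i, z i) = ∑ i, inner ℝ (z i) (z i) := by
    simp only [sum_inner, inner_sum]
    exact Finset.sum_congr rfl fun i _ =>
      Finset.sum_eq_single i (fun j _ hj => horth hj) (by simp)
  rw [real_inner_sub_sub_self, real_inner_comm (∑ i, z i) g, h1, h2] at h0
  linarith

theorem sum_trace_mul_trace_le [Fintype V] {G : SimpleGraph V} {n n' k k' : ℕ} {d d' : V → ℕ}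
    {M : ∀ v, Matrix (Fin n) (Fin (d v)) ℝ} {M' : ∀ v, Matrix (Fin n') (Fin (d' v)) ℝ}
    {H : Matrix (Fin n) (Fin k) ℝ} {H' : Matrix (Fin n') (Fin k') ℝ}
    (hM : IsMatrixRepresentation G M) (hM' : IsMatrixRepresentation Gᶜ M')
    (hH : IsKHandle H) (hH' : IsKHandle H') :
    ∑ v : V, ((M v)ᵀ * H * Hᵀ * M v).trace * ((M' v)ᵀ * H' * H'ᵀ * M' v).trace
      ≤ (k : ℝ) * (k' : ℝ) := by
  have key := sum_inner_self_le
    (fun v => projectedHandle (M v) H ⊗ₜ[ℝ] projectedHandle (M' v) H')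
    (flatten H ⊗ₜ[ℝ] flatten H')
    (fun u v huv => by
      simp only [TensorProduct.inner_tmul]
      -- Distinct vertices are non-adjacent in `G` or in `Gᶜ`, so one tensor factor always vanishes.
      by_cases hadj : G.Adj u v
      · rw [inner_projectedHandle_eq_zero (hM'.transpose_mul_eq_zero u v huv (by simp [hadj])),
          mul_zero]
      · rw [inner_projectedHandle_eq_zero (hM.transpose_mul_eq_zero u v huv hadj), zero_mul])
    (fun v => by
      simp only [TensorProduct.inner_tmul, inner_projectedHandle_flatten,
        inner_projectedHandle_self (hM.transpose_mul_self v),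
        inner_projectedHandle_self (hM'.transpose_mul_self v)])
  simpa only [TensorProduct.inner_tmul, inner_projectedHandle_self (hM.transpose_mul_self _),
    inner_projectedHandle_self (hM'.transpose_mul_self _), hH.inner_flatten_self,
    hH'.inner_flatten_self] using key

theorem theta_le {G : SimpleGraph V} {n : ℕ} {x : V → EuclideanSpace ℝ (Fin n)}
    {h : EuclideanSpace ℝ (Fin n)} (hx : IsOrthonormalRepresentation G x) (hh : IsHandle h) :
    theta G ≤ ⨆ v : V, 1 / ENNReal.ofReal (inner ℝ (x v) h ^ 2) :=
  iInf_le_of_le n <| iInf_le_of_le x <| iInf_le_of_le h <| iInf_le_of_le hx <| iInf_le _ hh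

theorem thetaF_le {G : SimpleGraph V} {k n : ℕ} {d : V → ℕ}
    {M : ∀ v, Matrix (Fin n) (Fin (d v)) ℝ} {H : Matrix (Fin n) (Fin k) ℝ} (hk : 0 < k)
    (hM : IsMatrixRepresentation G M) (hH : IsKHandle H) :
    thetaF G ≤ ⨆ v : V, (k : ℝ≥0∞) / ENNReal.ofReal ((M v)ᵀ * H * Hᵀ * M v).trace :=
  iInf_le_of_le k <| iInf_le_of_le hk <| iInf_le_of_le n <| iInf_le_of_le d <| iInf_le_of_le M <|
    iInf_le_of_le hM <| iInf_le_of_le H <| iInf_le _ hH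

/-- The standard basis of `ℝ^V` represents every graph; with the normalised all-ones vector as
handle its value is `|V|`. -/
theorem theta_ne_top [Fintype V] (G : SimpleGraph V) : theta G ≠ ⊤ := by
  classical
  rcases isEmpty_or_nonempty V with hV | hV
  · have hx : IsOrthonormalRepresentation G (fun _ : V => (0 : EuclideanSpace ℝ (Fin 1))) :=
      ⟨fun v => hV.elim v, fun u => hV.elim u⟩
    -- Dimension 1, because `ℝ⁰` contains no unit vector.
    have hh : IsHandle (EuclideanSpace.single (0 : Fin 1) (1 : ℝ)) := by simp [IsHandle]
    exact ne_top_of_le_ne_top (by simp) (theta_le hx hh)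
  · obtain ⟨c, hc⟩ : ∃ c : ℝ, c = Nat.cast (Fintype.card V) := ⟨_, rfl⟩
    have hc0 : 0 < c := by rw [hc]; exact_mod_cast Fintype.card_pos
    let e := Fintype.equivFin V
    let h : EuclideanSpace ℝ (Fin (Fintype.card V)) := WithLp.toLp 2 fun _ => (√c)⁻¹
    have hx : IsOrthonormalRepresentation G
        (fun v => EuclideanSpace.single (e v) (1 : ℝ)) := by
      refine ⟨fun v => by simp, fun u v huv _ => ?_⟩
      simp [EuclideanSpace.inner_single_left, huv]
    have hh : IsHandle h := by
      rw [IsHandle, ← sq_eq_sq₀ (norm_nonneg _) zero_le_one, EuclideanSpace.real_norm_sq_eq]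
      simp [h, inv_pow, Real.sq_sqrt hc0.le, ← hc, hc0.ne']
    refine ne_top_of_le_ne_top (b := 1 / ENNReal.ofReal ((√c)⁻¹ ^ 2)) ?_
      ((theta_le hx hh).trans (iSup_le fun v => le_of_eq ?_))
    · simpa using by positivity
    · simp [EuclideanSpace.inner_single_left, h]

theorem thetaF_le_theta (G : SimpleGraph V) : thetaF G ≤ theta G := by
  refine le_iInf fun n => le_iInf fun x => le_iInf fun h => le_iInf fun hx => le_iInf fun hh => ?_
  let M : ∀ _ : V, Matrix (Fin n) (Fin 1) ℝ := fun v => Matrix.of fun a _ => x v a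
  let H : Matrix (Fin n) (Fin 1) ℝ := Matrix.of fun a _ => h a
  have hinner : ∀ y z : EuclideanSpace ℝ (Fin n), inner ℝ y z = ∑ a, y a * z a := fun y z => by
    simp [PiLp.inner_apply, mul_comm]
  have hM : IsMatrixRepresentation G M := by
    refine ⟨fun _ => one_pos, fun v => ?_, fun u v huv hadj => ?_⟩
    · ext i j
      have := real_inner_self_eq_norm_sq (x v)
      rw [hx.norm_eq_one, hinner] at this
      simpa [M, Matrix.mul_apply, Matrix.one_apply, Subsingleton.elim i j] using this
    · ext i j
      have := hx.inner_eq_zero u v huv hadj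
      rw [hinner] at this
      simpa [M, Matrix.mul_apply] using this
  have hH : IsKHandle H := fun _ => hh
  refine (thetaF_le one_pos hM hH).trans (iSup_mono fun v => le_of_eq ?_)
  have : ((M v)ᵀ * H * Hᵀ * M v).trace = inner ℝ (x v) h ^ 2 := by
    rw [Matrix.mul_assoc, hinner, sq]
    simp [M, H, Matrix.trace, Matrix.mul_apply, mul_comm]
  rw [this, Nat.cast_one]

theorem theta_le_thetaF (G : SimpleGraph V) : theta G ≤ thetaF G := by
  refine le_iInf fun k => le_iInf fun hk => le_iInf fun n => le_iInf fun d => le_iInf fun M =>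
    le_iInf fun hM => le_iInf fun H => le_iInf fun hH => ?_
  have hself := fun v => inner_projectedHandle_self (hM.transpose_mul_self v) H
  have hflat := fun v => inner_projectedHandle_flatten (M v) H
  set t : V → ℝ := fun v => ((M v)ᵀ * H * Hᵀ * M v).trace
  have hk0 : (0 : ℝ) < k := by exact_mod_cast hk
  by_cases hpos : ∀ v, 0 < t v
  · have hnorm : ∀ v, ‖projectedHandle (M v) H‖ = √(t v) := fun v => by
      rw [norm_eq_sqrt_real_inner, hself]
    have hx : IsOrthonormalRepresentation G
        (fun v => (√(t v))⁻¹ • projectedHandle (M v) H) := by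
      refine ⟨fun v => ?_, fun u v huv hadj => ?_⟩
      · have := Real.sqrt_pos.2 (hpos v)
        rw [norm_smul, hnorm, Real.norm_of_nonneg (by positivity), inv_mul_cancel₀ this.ne']
      · rw [real_inner_smul_left, real_inner_smul_right,
          inner_projectedHandle_eq_zero (hM.transpose_mul_eq_zero u v huv hadj)]
        simp
    have hh : IsHandle ((√(k : ℝ))⁻¹ • flatten H) := by
      have := Real.sqrt_pos.2 hk0
      rw [IsHandle, norm_smul, norm_eq_sqrt_real_inner (flatten H), hH.inner_flatten_self,
        Real.norm_of_nonneg (by positivity), inv_mul_cancel₀ this.ne']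
    refine (theta_le hx hh).trans (iSup_mono fun v => le_of_eq ?_)
    -- `⟪z_v, g⟫ = t v`, so the square is `(t v)² / (t v * k)`.
    have hsq : inner ℝ ((√(t v))⁻¹ • projectedHandle (M v) H) ((√(k : ℝ))⁻¹ • flatten H) ^ 2
        = t v / k := by
      rw [real_inner_smul_left, real_inner_smul_right, hflat, mul_pow, mul_pow, inv_pow, inv_pow,
        Real.sq_sqrt (hpos v).le, Real.sq_sqrt hk0.le]
      have := (hpos v).ne'
      change (t v)⁻¹ * ((k : ℝ)⁻¹ * t v ^ 2) = t v / k
      field_simp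
    rw [hsq, ENNReal.ofReal_div_of_pos hk0, ENNReal.ofReal_natCast, one_div,
      ENNReal.inv_div (.inl (by simp)) (.inl (by simp [hk.ne']))]
  -- Some `z_v` is zero and cannot be normalised, but its quotient `k / 0` is `⊤`, so the bound is
  -- trivial.
  · obtain ⟨v, hv⟩ := not_forall.1 hpos
    refine le_top.trans (le_iSup_of_le v ?_)
    change ⊤ ≤ (k : ℝ≥0∞) / ENNReal.ofReal (t v)
    rw [ENNReal.ofReal_of_nonpos (not_lt.1 hv), ENNReal.div_zero (by exact_mod_cast hk.ne')]

end LovaszTheta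

theorem mainTheorem9 {V : Type*} [Fintype V] (G : SimpleGraph V) :
    LovaszTheta.thetaF G = LovaszTheta.theta G ∧ LovaszTheta.theta G ≠ ⊤ ∧
    ∀ (n n' k k' : ℕ) (d d' : V → ℕ)
      (M : ∀ v, Matrix (Fin n) (Fin (d v)) ℝ) (M' : ∀ v, Matrix (Fin n') (Fin (d' v)) ℝ)
      (H : Matrix (Fin n) (Fin k) ℝ) (H' : Matrix (Fin n') (Fin k') ℝ),
      0 < k → 0 < k' →
      LovaszTheta.IsMatrixRepresentation G M → LovaszTheta.IsMatrixRepresentation Gᶜ M' →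
      LovaszTheta.IsKHandle H → LovaszTheta.IsKHandle H' →
      ∑ v : V, ((M v)ᵀ * H * Hᵀ * M v).trace * ((M' v)ᵀ * H' * H'ᵀ * M' v).trace
        ≤ (k : ℝ) * (k' : ℝ) := by
  exact ⟨(LovaszTheta.thetaF_le_theta G).antisymm (LovaszTheta.theta_le_thetaF G),
    LovaszTheta.theta_ne_top G, fun _ _ _ _ _ _ _ _ _ _ _ _ hM hM' hH hH' =>
      LovaszTheta.sum_trace_mul_trace_le hM hM' hH hH'⟩
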